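/- Let $f:\mathbb{R}\to\mathbb{R}$ be piecewise smooth: $\mathbb{R}$ is a disjoint union of finitely many intervals (one-point intervals allowed), on each of which $f$ is continuously differentiable and either strictly monotonic or constant. A \emph{flat section} of $f$ is a nondegenerate interval on which $f$ is constant; assume that $f'(z)\neq 0$ for Lebesgue-almost every $z$ outside the flat sections. Let $Z\sim\mathcal{N}(0,1)$ and $Y=f(Z)$, and assume $H(\lfloor Y\rfloor)<\infty$, where $H$ is the Shannon entropy of a discrete random variable. Then the information dimension \[ d(Y)=\lim_{M\to\infty}\frac{H\left(\lfloor MY\rfloor/M\right)}{\log M} \] ($M$ ranging over the positive integers) and the conditional MMSE dimension \[ \mathscr{D}(Z|Y)=\lim_{\mathsf{snr}\to\infty}\mathsf{snr}\cdot\mathbb{E}\left[\left(Z-\mathbb{E}\left[Z\,\middle|\,\sqrt{\mathsf{snr}}\,Z+N,\;Y\right]\right)^2\right],\qquad N\sim\mathcal{N}(0,1)\text{ independent of }Z, \] both exist, and \[ d(Y)=1-\mathscr{D}(Z|Y). \] Moreover $\mathscr{D}(Z|Y)=\mathbb{P}\{f(Z)\in\mathcal{Q}_f\}$, where $\mathcal{Q}_f=\{y: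 f^{-1}(y)\text{ contains a nondegenerate interval}\}$, and this equals the probability that $Z$ lies in a flat section of $f$. -/

import Mathlib

open MeasureTheory ProbabilityTheory Filter Topology
open scoped ENNReal

/-- Shannon entropy (in nats) `∑ₓ -ℙ(W = x) log ℙ(W = x)` of a discrete random variable `W`,
with values in `[0, ∞]`. -/
noncomputable def discreteEntropy {Ω α : Type*} [MeasurableSpace Ω] (P : Measure Ω)
    (W : Ω → α) : ℝ≥0∞ :=
  ∑' x : α, ENNReal.ofReal (Real.negMulLog (P.real (W ⁻¹' {x})))

/-- The quantization `⟨x⟩_M = ⌊M x⌋ / M`. -/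
noncomputable def quantize (M : ℕ) (x : ℝ) : ℝ := (⌊(M : ℝ) * x⌋ : ℝ) / M

/-- The information dimension `lim_{M → ∞} H(⟨X⟩_M) / log M` of the real random variable `X`
exists and equals `d`. -/
def HasInformationDimension {Ω : Type*} [MeasurableSpace Ω] (P : Measure Ω) (X : Ω → ℝ)
    (d : ℝ) : Prop :=
  (∀ᶠ M : ℕ in atTop, discreteEntropy P (fun ω => quantize M (X ω)) ≠ ∞) ∧
  Tendsto (fun M : ℕ => (discreteEntropy P (fun ω => quantize M (X ω))).toReal / Real.log M)
    atTop (𝓝 d)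

/-- The conditional MMSE `mmse(Z, snr | U) = 𝔼[(Z - 𝔼[Z | √snr Z + N, U])²]`, where the noise
`N ∼ 𝒩(0,1)` is independent of `(Z, U)`. Here `N` is the second coordinate on `Ω × ℝ`
under the product measure `P ⊗ 𝒩(0,1)`. -/
noncomputable def condMMSE {Ω β : Type*} [MeasurableSpace Ω] [MeasurableSpace β]
    (P : Measure Ω) (Z : Ω → ℝ) (U : Ω → β) (snr : ℝ) : ℝ :=
  ∫ p : Ω × ℝ,
    (Z p.1 -
      ((P.prod (gaussianReal 0 1))[fun q : Ω × ℝ => Z q.1 |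
        MeasurableSpace.comap (fun q : Ω × ℝ => (√snr * Z q.1 + q.2, U q.1)) inferInstance]) p) ^ 2
    ∂(P.prod (gaussianReal 0 1))

/-- The conditional MMSE dimension `𝒟(Z | U) = lim_{snr → ∞} snr · mmse(Z, snr | U)` exists and
equals `D`. -/
def HasCondMMSEDimension {Ω β : Type*} [MeasurableSpace Ω] [MeasurableSpace β]
    (P : Measure Ω) (Z : Ω → ℝ) (U : Ω → β) (D : ℝ) : Prop :=
  Tendsto (fun snr : ℝ => snr * condMMSE P Z U snr) atTop (𝓝 D)

/-- `ℝ` is a disjoint union of finitely many intervals (of any kind, one-point intervals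
included), on each of which `f` is `C¹` and either strictly monotonic or constant. -/
def IsPiecewiseSmooth (f : ℝ → ℝ) : Prop :=
  ∃ (K : ℕ) (I : Fin K → Set ℝ),
    (∀ k, (I k).OrdConnected) ∧
    (∀ j k, j ≠ k → Disjoint (I j) (I k)) ∧
    (⋃ k, I k) = Set.univ ∧
    ∀ k, ContDiffOn ℝ 1 f (I k) ∧
      (StrictMonoOn f (I k) ∨ StrictAntiOn f (I k) ∨ ∃ c, ∀ x ∈ I k, f x = c)

/-- The values `y` for which `f⁻¹(y)` contains a (nondegenerate) interval. -/
def flatValues (f : ℝ → ℝ) : Set ℝ :=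
  {y | ∃ a b : ℝ, a < b ∧ Set.Ioo a b ⊆ f ⁻¹' {y}}

/-- The union of the flat sections of `f`: the points lying in some nondegenerate interval on
which `f` is constant. -/
def flatSections (f : ℝ → ℝ) : Set ℝ :=
  {z | ∃ a b : ℝ, a < b ∧ z ∈ Set.Icc a b ∧ ∀ w ∈ Set.Icc a b, f w = f z}

/-! Write `Q = flatValues f` and `p = P(f(Z) ∈ Q)`. The set `Q` is finite, and almost every point is
either interior to a level set or interior to a piece where `f` is injective, with value outside `Q`
(`ae_flat_or_injOn`). This dichotomy identifies `p` with the probability of the flat sections and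
drives both limits.

Information dimension: since `f' ≠ 0` almost everywhere off the flat sections, the area formula
makes the law of `Y` absolutely continuous off `Q`. Finitely many atoms contribute bounded entropy,
so Rényi's theorem (`tendsto_discreteEntropy_floor_mul`) gives `d(Y) = 1 - p`.

MMSE, upper bound: given a value of `Y` outside `Q`, almost surely `Z` is one of finitely many
candidates, and the one nearest to the observation is exactly `Z` once the noise is small. At a flat
value the rescaled observation errs by `N / √snr`. Dominated convergence gives the limit `p · E[N²]
= p` for this estimator.

MMSE, lower bound: for a flat value `y`, let `A` be the interior of its level set. In the variables
`x = z + n / √snr` and `n`, any estimator depends on `x` alone, so its scaled error is a function of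
`x` minus `n`. Replacing the weight by a minorant even in `n` makes `0` the best prediction of `n`
(`lintegral_even_mul_sq_le`). Fatou's lemma lets the minorants recover the full mass of each `A`
(`sum_gaussianReal_le_liminf`). -/

/-! ### Geometry of piecewise smooth functions and their flat values. -/

/-- A partition of `ℝ` into intervals witnessing that `f` is piecewise smooth. -/
structure IsSmoothPartition (f : ℝ → ℝ) {K : ℕ} (I : Fin K → Set ℝ) : Prop where
  ordConnected : ∀ k, (I k).OrdConnected
  iUnion_eq : (⋃ k, I k) = Set.univ
  contDiffOn : ∀ k, ContDiffOn ℝ 1 f (I k)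
  const_of_not_injOn : ∀ k, ¬ Set.InjOn f (I k) → ∃ c, ∀ x ∈ I k, f x = c

theorem IsPiecewiseSmooth.exists_isSmoothPartition {f : ℝ → ℝ} (hf : IsPiecewiseSmooth f) :
    ∃ (K : ℕ) (I : Fin K → Set ℝ), IsSmoothPartition f I := by
  obtain ⟨K, I, h1, -, h3, h4⟩ := hf
  refine ⟨K, I, h1, h3, fun k => (h4 k).1, fun k hk => ?_⟩
  rcases (h4 k).2 with h | h | h
  · exact (hk h.injOn).elim
  · exact (hk h.injOn).elim
  · exact h

namespace IsSmoothPartition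

variable {f : ℝ → ℝ} {K : ℕ} {I : Fin K → Set ℝ}

theorem exists_mem (h : IsSmoothPartition f I) (z : ℝ) : ∃ k, z ∈ I k := by
  have : z ∈ ⋃ k, I k := by rw [h.iUnion_eq]; trivial
  simpa using this

theorem measurable (h : IsSmoothPartition f I) : Measurable f := by
  intro B hB
  have : f ⁻¹' B = ⋃ k, (I k ∩ f ⁻¹' B) := by
    rw [← Set.iUnion_inter, h.iUnion_eq, Set.univ_inter]
  rw [this]
  refine MeasurableSet.iUnion fun k => ?_
  rw [← Subtype.image_preimage_coe]
  exact (h.ordConnected k).measurableSet.subtype_image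
    ((continuousOn_iff_continuous_domRestrict.1 (h.contDiffOn k).continuousOn).measurable hB)

/-- By pigeonhole, an interval on which `f` equals `y` meets some piece in infinitely many points.
That piece is not injective, hence constant with value `y`, and there are finitely many pieces. -/
theorem finite_flatValues (h : IsSmoothPartition f I) : (flatValues f).Finite := by
  have hfin : (⋃ k, {y | ¬ Set.InjOn f (I k) ∧ ∀ x ∈ I k, f x = y}).Finite := by
    refine Set.finite_iUnion fun k => Set.Subsingleton.finite ?_
    rintro y ⟨h1, h2⟩ y' ⟨-, h2'⟩
    obtain ⟨x, hx⟩ : (I k).Nonempty := by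
      rw [Set.nonempty_iff_ne_empty]; rintro h0; exact h1 (by simp [h0])
    rw [← h2 x hx, h2' x hx]
  refine hfin.subset ?_
  rintro y ⟨a, b, hab, hy⟩
  have hinf : (Set.Ioo a b).Infinite := Set.Ioo_infinite hab
  have : Set.Ioo a b = ⋃ k, (I k ∩ Set.Ioo a b) := by
    rw [← Set.iUnion_inter, h.iUnion_eq, Set.univ_inter]
  rw [this] at hinf
  obtain ⟨k, hk⟩ : ∃ k, (I k ∩ Set.Ioo a b).Infinite := by
    by_contra! hcon
    exact hinf (Set.finite_iUnion fun k => Set.not_infinite.1 (by simpa using hcon k))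
  have hnot : ¬ Set.InjOn f (I k) := by
    intro hinj
    refine hk (Set.Subsingleton.finite ?_)
    intro x hx x' hx'
    exact hinj hx.1 hx'.1 ((hy hx.2).trans (hy hx'.2).symm)
  obtain ⟨c, hc⟩ := h.const_of_not_injOn k hnot
  obtain ⟨x, hx⟩ := hk.nonempty
  refine Set.mem_iUnion.2 ⟨k, hnot, fun x' hx' => ?_⟩
  rw [hc x' hx', ← hc x hx.1]
  exact hy hx.2

theorem ae_mem_interior (h : IsSmoothPartition f I) :
    ∀ᵐ z : ℝ, ∃ k, z ∈ interior (I k) := by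
  have hfr : ∀ᵐ z : ℝ, ∀ k, z ∉ frontier (I k) := by
    rw [ae_all_iff]
    intro k
    exact measure_eq_zero_iff_ae_notMem.1 ((h.ordConnected k).convex.addHaar_frontier volume)
  filter_upwards [hfr] with z hz
  obtain ⟨k, hk⟩ := h.exists_mem z
  exact ⟨k, by by_contra hcon; exact hz k ⟨subset_closure hk, hcon⟩⟩

/-- An injective piece takes each of the finitely many flat values at most once, so the exceptional
set is finite. -/
theorem ae_notMem_flatValues (h : IsSmoothPartition f I) :
    ∀ᵐ z : ℝ, ∀ k, Set.InjOn f (I k) → z ∈ I k → f z ∉ flatValues f := by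
  rw [ae_all_iff]
  intro k
  by_cases hinj : Set.InjOn f (I k)
  · have hfin : (I k ∩ f ⁻¹' flatValues f).Finite := by
      refine Set.Finite.of_finite_image
        (h.finite_flatValues.subset (by rintro _ ⟨x, hx, rfl⟩; exact hx.2))
        (hinj.mono Set.inter_subset_left)
    filter_upwards [measure_eq_zero_iff_ae_notMem.1 (hfin.measure_zero volume)] with z hz _ hk hq
    exact hz ⟨hk, hq⟩
  · exact Eventually.of_forall fun z hz => (hinj hz).elim

end IsSmoothPartition

theorem map_mem_flatValues_of_mem_flatSections {f : ℝ → ℝ} {z : ℝ} (hz : z ∈ flatSections f) :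
    f z ∈ flatValues f := by
  obtain ⟨a, b, hab, -, h⟩ := hz
  exact ⟨a, b, hab, fun w hw => h w (Set.Ioo_subset_Icc_self hw)⟩

theorem mem_flatSections_of_mem_interior {f : ℝ → ℝ} {z : ℝ}
    (hz : z ∈ interior (f ⁻¹' {f z})) : z ∈ flatSections f := by
  obtain ⟨ε, hε, hb⟩ := Metric.isOpen_iff.1 isOpen_interior z hz
  refine ⟨z - ε / 2, z + ε / 2, by linarith, ⟨by linarith, by linarith⟩, fun w hw => ?_⟩
  have hw' : w ∈ f ⁻¹' {f z} := by
    refine interior_subset (hb ?_)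
    rw [Metric.mem_ball, Real.dist_eq, abs_lt]
    constructor <;> linarith [hw.1, hw.2]
  exact hw'

/-- Almost every point is interior to a level set, or it is interior to a piece on which `f` is
injective and its value is not a flat value. -/
theorem IsSmoothPartition.ae_flat_or_injOn {f : ℝ → ℝ} {K : ℕ} {I : Fin K → Set ℝ}
    (h : IsSmoothPartition f I) :
    ∀ᵐ z : ℝ, (f z ∈ flatValues f ∧ z ∈ flatSections f ∧ z ∈ interior (f ⁻¹' {f z})) ∨
      (f z ∉ flatValues f ∧ z ∉ flatSections f ∧ ∃ k, Set.InjOn f (I k) ∧ z ∈ interior (I k)) := by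
  filter_upwards [h.ae_mem_interior, h.ae_notMem_flatValues] with z ⟨k, hk⟩ h2
  by_cases hinj : Set.InjOn f (I k)
  · have h3 := h2 k hinj (interior_subset hk)
    exact Or.inr ⟨h3, fun hcon => h3 (map_mem_flatValues_of_mem_flatSections hcon), k, hinj, hk⟩
  · obtain ⟨c, hc⟩ := h.const_of_not_injOn k hinj
    have hint : z ∈ interior (f ⁻¹' {f z}) := by
      refine interior_mono (fun x hx => ?_) hk
      rw [Set.mem_preimage, Set.mem_singleton_iff, hc x hx, hc z (interior_subset hk)]
    have hs := mem_flatSections_of_mem_interior hint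
    exact Or.inl ⟨map_mem_flatValues_of_mem_flatSections hs, hs, hint⟩

/-- Off the flat values the image of Lebesgue measure is absolutely continuous. -/
theorem IsSmoothPartition.volume_preimage_diff_flatValues {f : ℝ → ℝ} {K : ℕ}
    {I : Fin K → Set ℝ} (h : IsSmoothPartition f I)
    (hcrit : ∀ᵐ z : ℝ ∂volume, z ∉ flatSections f → deriv f z ≠ 0)
    {B : Set ℝ} (hB : MeasurableSet B) (hB0 : volume B = 0) :
    volume (f ⁻¹' (B \ flatValues f)) = 0 := by
  have key : ∀ᵐ z : ℝ, ∀ k, Set.InjOn f (I k) → z ∈ interior (I k) ∩ f ⁻¹' B → deriv f z = 0 := by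
    rw [ae_all_iff]
    intro k
    by_cases hinj : Set.InjOn f (I k)
    · have hms : MeasurableSet (interior (I k) ∩ f ⁻¹' B) :=
        isOpen_interior.measurableSet.inter (h.measurable hB)
      have hder : ∀ x ∈ interior (I k) ∩ f ⁻¹' B,
          HasDerivWithinAt f (deriv f x) (interior (I k) ∩ f ⁻¹' B) x := by
        intro x hx
        have : DifferentiableAt ℝ f x :=
          ((h.contDiffOn k).contDiffAt (mem_interior_iff_mem_nhds.1 hx.1)).differentiableAt
            one_ne_zero
        exact this.hasDerivAt.hasDerivWithinAt
      -- Area formula: the integral of `|f'|` over this set is the volume of its image, which lies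
      -- in the null set `B`.
      have hj := lintegral_image_eq_lintegral_abs_deriv_mul hms hder
        (hinj.mono (Set.inter_subset_left.trans interior_subset)) (fun _ => 1)
      have himg : volume (f '' (interior (I k) ∩ f ⁻¹' B)) = 0 :=
        measure_mono_null (by rintro _ ⟨x, hx, rfl⟩; exact hx.2) hB0
      rw [lintegral_one, Measure.restrict_apply_univ, himg] at hj
      have h0 := (lintegral_eq_zero_iff (by
        have := measurable_deriv f
        fun_prop)).1 hj.symm
      filter_upwards [(ae_restrict_iff' hms).1 h0] with z hz _ hmem
      have := hz hmem
      simpa using this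
    · exact Eventually.of_forall fun z hz => (hinj hz).elim
  rw [measure_eq_zero_iff_ae_notMem]
  filter_upwards [key, hcrit, h.ae_flat_or_injOn] with z h1 h2 h3 hmem
  rcases h3 with h3 | ⟨-, h4, k, hk, hz⟩
  · exact hmem.2 h3.1
  · exact h2 h4 (h1 k hk ⟨hz, hmem.1⟩)

/-! ### Entropy of quantized variables and Rényi's theorem. -/

theorem discreteEntropy_comp_injective {Ω α β : Type*} [MeasurableSpace Ω] (P : Measure Ω)
    (W : Ω → α) {g : α → β} (hg : Function.Injective g) :
    discreteEntropy P (fun ω => g (W ω)) = discreteEntropy P W := by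
  unfold discreteEntropy
  rw [← hg.tsum_eq]
  · refine tsum_congr fun x => ?_
    congr 3
    ext ω
    simp [hg.eq_iff]
  · intro y hy
    by_contra hcon
    apply hy
    have : (fun ω => g (W ω)) ⁻¹' {y} = ∅ := by
      ext ω
      simp only [Set.mem_preimage, Set.mem_singleton_iff, Set.mem_empty_iff_false, iff_false]
      rintro rfl
      exact hcon ⟨_, rfl⟩
    simp [this]

theorem discreteEntropy_map {Ω α β : Type*} [MeasurableSpace Ω] [MeasurableSpace α]
    [MeasurableSpace β] [MeasurableSingletonClass β] (P : Measure Ω) {Y : Ω → α}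
    (hY : Measurable Y) {T : α → β} (hT : Measurable T) :
    discreteEntropy P (fun ω => T (Y ω)) = discreteEntropy (P.map Y) T := by
  unfold discreteEntropy
  refine tsum_congr fun x => ?_
  rw [map_measureReal_apply hY (hT (measurableSet_singleton x))]
  rfl

theorem discreteEntropy_quantize {Ω : Type*} [MeasurableSpace Ω] (P : Measure Ω) (X : Ω → ℝ)
    {M : ℕ} (hM : M ≠ 0) :
    discreteEntropy P (fun ω => quantize M (X ω)) =
      discreteEntropy P (fun ω => ⌊(M : ℝ) * X ω⌋) := by
  refine discreteEntropy_comp_injective P (fun ω => ⌊(M : ℝ) * X ω⌋)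
    (g := fun j : ℤ => (j : ℝ) / M) ?_
  intro a b hab
  have : (M : ℝ) ≠ 0 := by exact_mod_cast hM
  field_simp at hab
  exact_mod_cast hab

/-- Changing the law of a quantized variable on finitely many cells changes its entropy by at most
the number of cells. -/
theorem discreteEntropy_le_add_card {α ι : Type*} [MeasurableSpace α] (ν ν' : Measure α)
    (T : α → ι) (J : Finset ι)
    (h : ∀ j ∉ J, ν.real (T ⁻¹' {j}) = ν'.real (T ⁻¹' {j})) :
    discreteEntropy ν T ≤ discreteEntropy ν' T + J.card := by
  classical
  unfold discreteEntropy
  have hJ : ∑' j, (if j ∈ J then (1 : ℝ≥0∞) else 0) = J.card := by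
    rw [tsum_eq_sum (s := J) (fun j hj => by simp [hj])]
    simp
  rw [← hJ, ← ENNReal.tsum_add]
  refine ENNReal.tsum_le_tsum fun j => ?_
  by_cases hj : j ∈ J
  · rw [if_pos hj]
    refine le_add_left ?_
    rw [← ENNReal.ofReal_one]
    refine ENNReal.ofReal_le_ofReal ?_
    have := Real.negMulLog_le_one_sub_self (measureReal_nonneg (μ := ν) (s := T ⁻¹' {j}))
    have := measureReal_nonneg (μ := ν) (s := T ⁻¹' {j})
    linarith
  · simp [hj, h j hj]

/-- Jensen's inequality for the concave function `-x log x` with uniform weights; the masses need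
not sum to one. -/
theorem sum_negMulLog_le {ι : Type*} [Fintype ι] [Nonempty ι] (a : ι → ℝ) (ha : ∀ i, 0 ≤ a i) :
    ∑ i, Real.negMulLog (a i) ≤
      Real.negMulLog (∑ i, a i) + (∑ i, a i) * Real.log (Fintype.card ι) := by
  have hc : (0 : ℝ) < Fintype.card ι := by exact_mod_cast Fintype.card_pos
  have hj := Real.concaveOn_negMulLog.le_map_sum (t := Finset.univ)
    (w := fun _ : ι => (Fintype.card ι : ℝ)⁻¹) (p := a) (fun i _ => by positivity)
    (by simp [hc.ne']) (fun i _ => ha i)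
  simp only [smul_eq_mul, ← Finset.mul_sum] at hj
  rw [mul_comm (Fintype.card ι : ℝ)⁻¹ (∑ i, a i), Real.negMulLog_mul] at hj
  have h2 : Real.negMulLog (Fintype.card ι : ℝ)⁻¹ =
      (Fintype.card ι : ℝ)⁻¹ * Real.log (Fintype.card ι) := by
    rw [Real.negMulLog, Real.log_inv]; ring
  rw [h2] at hj
  have := mul_le_mul_of_nonneg_left hj hc.le
  field_simp at this
  linarith

/-- Refining every cell of a partition into at most `card κ` pieces adds at most `log (card κ)`
to the entropy, weighted by the total mass. -/
theorem discreteEntropy_prod_le {α ι κ : Type*} [MeasurableSpace α] [MeasurableSpace ι]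
    [MeasurableSingletonClass ι] [Countable ι] [Fintype κ] [Nonempty κ] [MeasurableSpace κ]
    [MeasurableSingletonClass κ] (ν : Measure α) [IsFiniteMeasure ν] (hν : ν Set.univ ≤ 1)
    {φ : α → ι × κ} (hφ : Measurable φ) :
    discreteEntropy ν φ ≤ discreteEntropy ν (fun x => (φ x).1) +
      ENNReal.ofReal (ν.real Set.univ * Real.log (Fintype.card κ)) := by
  have hle : ∀ s : Set α, ν.real s ≤ 1 := fun s =>
    (ENNReal.toReal_mono ENNReal.one_ne_top ((measure_mono (Set.subset_univ s)).trans hν)).trans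
      (by simp)
  have hlog : 0 ≤ Real.log (Fintype.card κ) := Real.log_natCast_nonneg _
  have h1 : Measurable fun x => (φ x).1 := measurable_fst.comp hφ
  have hsum : ∀ n, ∑ i : κ, ν.real (φ ⁻¹' {(n, i)}) = ν.real ((fun x => (φ x).1) ⁻¹' {n}) := by
    intro n
    have : (fun x => (φ x).1) ⁻¹' {n} = ⋃ i, φ ⁻¹' {(n, i)} := by
      ext x; simp [Prod.ext_iff]
    rw [this, measureReal_iUnion_fintype]
    · intro i j hij
      exact Disjoint.preimage _ (by simpa using hij)
    · exact fun i => hφ (measurableSet_singleton _)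
  have htot : ∑' n, ENNReal.ofReal (ν.real ((fun x => (φ x).1) ⁻¹' {n}) *
      Real.log (Fintype.card κ)) = ENNReal.ofReal (ν.real Set.univ * Real.log (Fintype.card κ)) := by
    rw [tsum_congr fun n => ENNReal.ofReal_mul measureReal_nonneg,
      ENNReal.ofReal_mul measureReal_nonneg, ENNReal.tsum_mul_right,
      tsum_congr fun n => ofReal_measureReal (μ := ν) (s := (fun x => (φ x).1) ⁻¹' {n}),
      ofReal_measureReal]
    congr 1
    have := tsum_measure_preimage_singleton (μ := ν) (Set.to_countable (Set.univ : Set ι))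
      (f := fun x => (φ x).1) (fun y _ => h1 (measurableSet_singleton y))
    rw [Set.preimage_univ, tsum_univ (fun n => ν ((fun x => (φ x).1) ⁻¹' {n}))] at this
    exact this
  unfold discreteEntropy
  rw [← htot, ← ENNReal.tsum_add, ENNReal.tsum_prod']
  refine ENNReal.tsum_le_tsum fun n => ?_
  rw [tsum_fintype, ← ENNReal.ofReal_sum_of_nonneg
    (fun i _ => Real.negMulLog_nonneg measureReal_nonneg (hle _)),
    ← ENNReal.ofReal_add (Real.negMulLog_nonneg measureReal_nonneg (hle _))
      (mul_nonneg measureReal_nonneg hlog)]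
  refine ENNReal.ofReal_le_ofReal ?_
  have := sum_negMulLog_le (fun i => ν.real (φ ⁻¹' {(n, i)})) (fun i => measureReal_nonneg)
  rwa [hsum] at this

theorem discreteEntropy_floor_mul_le (ν : Measure ℝ) [IsFiniteMeasure ν] (hν : ν Set.univ ≤ 1)
    {M : ℕ} (hM : M ≠ 0) :
    discreteEntropy ν (fun y => ⌊(M : ℝ) * y⌋) ≤ discreteEntropy ν (fun y => ⌊y⌋) +
      ENNReal.ofReal (ν.real Set.univ * Real.log M) := by
  have : NeZero M := ⟨hM⟩
  -- Division by `M` encodes `⌊M y⌋` as the pair of its quotient `⌊y⌋` and a remainder with `M`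
  -- possible values.
  have hφ : Measurable fun y : ℝ => Int.divModEquiv M ⌊(M : ℝ) * y⌋ :=
    (measurable_of_countable (Int.divModEquiv M)).comp
      (Int.measurable_floor.comp (measurable_const_mul _))
  have h := discreteEntropy_prod_le ν hν hφ
  rw [discreteEntropy_comp_injective ν (fun y : ℝ => ⌊(M : ℝ) * y⌋)
    (Int.divModEquiv M).injective] at h
  simpa [Int.natCast_mul_floor_div_cancel hM] using h

/-- Cells of mass exceeding `C / M` have total volume at most `1 / C`, so they carry little of an
absolutely continuous measure. -/
theorem volume_iUnion_floor_le (α : Measure ℝ) (hα : α Set.univ ≤ 1) {M : ℕ} (hM : M ≠ 0)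
    (C : ℝ≥0∞) (B : Set ℤ)
    (hB : ∀ j ∈ B, C / M ≤ α ((fun y : ℝ => ⌊(M : ℝ) * y⌋) ⁻¹' {j})) :
    volume ((fun y : ℝ => ⌊(M : ℝ) * y⌋) ⁻¹' B) ≤ C⁻¹ := by
  have hT : Measurable (fun y : ℝ => ⌊(M : ℝ) * y⌋) :=
    Int.measurable_floor.comp (measurable_const_mul _)
  have hM0 : (0 : ℝ) < M := by positivity
  have hvol : ∀ j : ℤ, volume ((fun y : ℝ => ⌊(M : ℝ) * y⌋) ⁻¹' {j}) = (M : ℝ≥0∞)⁻¹ := by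
    intro j
    have : (fun y : ℝ => ⌊(M : ℝ) * y⌋) ⁻¹' {j} = Set.Ico ((j : ℝ) / M) (((j : ℝ) + 1) / M) := by
      ext y
      simp only [Set.mem_preimage, Set.mem_singleton_iff, Int.floor_eq_iff, Set.mem_Ico]
      rw [div_le_iff₀ hM0, lt_div_iff₀ hM0, mul_comm]
    rw [this, Real.volume_Ico, ← sub_div, add_sub_cancel_left, one_div,
      ENNReal.ofReal_inv_of_pos hM0, ENNReal.ofReal_natCast]
  have hsum : ∀ μ : Measure ℝ, μ ((fun y : ℝ => ⌊(M : ℝ) * y⌋) ⁻¹' B) =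
      ∑' j : B, μ ((fun y : ℝ => ⌊(M : ℝ) * y⌋) ⁻¹' {(j : ℤ)}) := fun μ =>
    (tsum_measure_preimage_singleton B.to_countable
      (fun y _ => hT (measurableSet_singleton y))).symm
  rw [hsum volume]
  simp_rw [hvol]
  have h1 : C * ∑' _ : B, (M : ℝ≥0∞)⁻¹ ≤ 1 := by
    rw [← ENNReal.tsum_mul_left]
    calc _ ≤ ∑' j : B, α ((fun y : ℝ => ⌊(M : ℝ) * y⌋) ⁻¹' {(j : ℤ)}) :=
          ENNReal.tsum_le_tsum fun j => hB j j.2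
      _ = α ((fun y : ℝ => ⌊(M : ℝ) * y⌋) ⁻¹' B) := (hsum α).symm
      _ ≤ 1 := (measure_mono (Set.subset_univ _)).trans hα
  rw [ENNReal.le_inv_iff_mul_le, mul_comm]
  exact h1

theorem exists_pos_measure_lt_of_absolutelyContinuous {α : Type*} [MeasurableSpace α]
    {μ ν : Measure α} [IsFiniteMeasure μ] [SigmaFinite ν] (h : μ ≪ ν) {ε : ℝ≥0∞} (hε : ε ≠ 0) :
    ∃ δ > 0, ∀ s, ν s < δ → μ s < ε := by
  obtain ⟨δ, hδ, hs⟩ := exists_pos_setLIntegral_lt_of_measure_lt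
    (f := μ.rnDeriv ν) (μ := ν) (Measure.lintegral_rnDeriv_lt_top μ ν).ne hε
  exact ⟨δ, hδ, fun s hlt => by simpa [Measure.setLIntegral_rnDeriv h] using hs s hlt⟩

/-- A cell outside `J` of mass `q < C / M` contributes `-q log q ≥ q log (M / C)` to the entropy.
The remaining mass of `α` is lost: cells of mass at least `C / M` carry at most `ε` in total, and
light cells in `J` at most `C / M` each. -/
theorem log_mul_measure_univ_le (ν α : Measure ℝ) [IsProbabilityMeasure ν] [IsFiniteMeasure α]
    (hα : α Set.univ ≤ 1) {M : ℕ} {C : ℝ} (hC : 0 < C) (hCM : C ≤ M) (J : Finset ℤ)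
    (hJ : ∀ j ∉ J, ν.real ((fun y : ℝ => ⌊(M : ℝ) * y⌋) ⁻¹' {j}) =
      α.real ((fun y : ℝ => ⌊(M : ℝ) * y⌋) ⁻¹' {j}))
    {ε : ℝ≥0∞} (hε : ∀ s, volume s ≤ (ENNReal.ofReal C)⁻¹ → α s ≤ ε) :
    ENNReal.ofReal (Real.log (M / C)) * α Set.univ ≤
      discreteEntropy ν (fun y => ⌊(M : ℝ) * y⌋) +
        ENNReal.ofReal (Real.log (M / C)) * (ε + J.card * ENNReal.ofReal (C / M)) := by
  classical
  set T : ℝ → ℤ := fun y => ⌊(M : ℝ) * y⌋ with hTdef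
  have hT : Measurable T := Int.measurable_floor.comp (measurable_const_mul _)
  have hM0 : (0 : ℝ) < M := hC.trans_le hCM
  have hM : M ≠ 0 := by rintro rfl; simp at hM0
  have hdiv : ENNReal.ofReal (C / M) = ENNReal.ofReal C / M := by
    rw [ENNReal.ofReal_div_of_pos hM0, ENNReal.ofReal_natCast]
  set B : Set ℤ := {j | ENNReal.ofReal (C / M) ≤ α (T ⁻¹' {j})} with hB
  have hBε : ∑' j, B.indicator (fun j => α (T ⁻¹' {j})) j ≤ ε := by
    rw [← tsum_subtype, tsum_measure_preimage_singleton B.to_countable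
      (fun y _ => hT (measurableSet_singleton y))]
    refine hε _ (volume_iUnion_floor_le α hα hM _ B fun j hj => ?_)
    rw [← hdiv]; exact hj
  have hJs : ∑' j, (if j ∈ J then ENNReal.ofReal (C / M) else 0) =
      J.card * ENNReal.ofReal (C / M) := by
    rw [tsum_eq_sum (s := J) (fun j hj => by simp [hj])]
    simp
  have huniv : ∑' j, α (T ⁻¹' {j}) = α Set.univ := by
    have := tsum_measure_preimage_singleton (μ := α) (Set.to_countable (Set.univ : Set ℤ))
      (f := T) (fun y _ => hT (measurableSet_singleton y))
    rw [Set.preimage_univ, tsum_univ (fun n => α (T ⁻¹' {n}))] at this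
    exact this
  calc ENNReal.ofReal (Real.log (M / C)) * α Set.univ
      = ∑' j, ENNReal.ofReal (Real.log (M / C)) * α (T ⁻¹' {j}) := by
        rw [ENNReal.tsum_mul_left, huniv]
    _ ≤ ∑' j, (ENNReal.ofReal (Real.negMulLog (ν.real (T ⁻¹' {j}))) +
          ENNReal.ofReal (Real.log (M / C)) * (B.indicator (fun j => α (T ⁻¹' {j})) j +
            (if j ∈ J then ENNReal.ofReal (C / M) else 0))) := by
        refine ENNReal.tsum_le_tsum fun j => ?_
        by_cases hjB : j ∈ B
        · refine le_add_left (mul_le_mul_right ?_ _)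
          rw [Set.indicator_of_mem hjB]
          exact le_self_add
        have hlt : α (T ⁻¹' {j}) < ENNReal.ofReal (C / M) := not_le.1 hjB
        by_cases hjJ : j ∈ J
        · refine le_add_left (mul_le_mul_right ?_ _)
          rw [if_pos hjJ]
          exact le_add_left hlt.le
        · refine le_add_right ?_
          rw [hJ j hjJ, ← ofReal_measureReal (μ := α), ← ENNReal.ofReal_mul
            (Real.log_nonneg (by rwa [one_le_div hC]))]
          refine ENNReal.ofReal_le_ofReal ?_
          have hle : α.real (T ⁻¹' {j}) ≤ C / M :=
            ENNReal.toReal_le_of_le_ofReal (by positivity) hlt.le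
          rcases (measureReal_nonneg (μ := α) (s := T ⁻¹' {j})).eq_or_lt' with h0 | h0
          · rw [h0]; simp
          · rw [Real.negMulLog]
            have h1 := Real.log_le_log h0 hle
            have h2 : Real.log (M / C) = - Real.log (C / M) := by
              rw [← Real.log_inv, inv_div]
            rw [h2]
            nlinarith
    _ ≤ _ := by
        rw [ENNReal.tsum_add, ENNReal.tsum_mul_left, ENNReal.tsum_add, hJs]
        unfold discreteEntropy
        gcongr

/-- **Rényi's theorem**: a law that is absolutely continuous off a finite set `Q` has information
dimension equal to its mass off `Q`. -/
theorem tendsto_discreteEntropy_floor_mul (ν : Measure ℝ) [IsProbabilityMeasure ν] {Q : Set ℝ}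
    (hQ : Q.Finite) (hac : ν.restrict Qᶜ ≪ volume)
    (hH : discreteEntropy ν (fun y => ⌊y⌋) ≠ ∞) :
    (∀ M : ℕ, M ≠ 0 → discreteEntropy ν (fun y => ⌊(M : ℝ) * y⌋) ≠ ∞) ∧
    Tendsto (fun M : ℕ => (discreteEntropy ν (fun y => ⌊(M : ℝ) * y⌋)).toReal / Real.log M)
      atTop (𝓝 (ν.real Qᶜ)) := by
  classical
  set α := ν.restrict Qᶜ with hαdef
  have hα1 : α Set.univ ≤ 1 := by
    rw [hαdef, Measure.restrict_apply_univ]; exact prob_le_one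
  have hαr : α.real Set.univ = ν.real Qᶜ := by
    simp [hαdef, measureReal_def]
  set N := hQ.toFinset.card with hN
  have hcell : ∀ T : ℝ → ℤ, Measurable T → ∀ j ∉ hQ.toFinset.image T,
      ν.real (T ⁻¹' {j}) = α.real (T ⁻¹' {j}) := by
    intro T hT j hj
    rw [hαdef, measureReal_restrict_apply (hT (measurableSet_singleton j))]
    congr 1
    have hsub : T ⁻¹' {j} ⊆ Qᶜ := fun y hy hyQ =>
      hj (Finset.mem_image.2 ⟨y, by simpa using hyQ, hy⟩)
    exact (Set.inter_eq_left.2 hsub).symm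
  have hcard : ∀ T : ℝ → ℤ, ((hQ.toFinset.image T).card : ℝ≥0∞) ≤ N := fun T => by
    exact_mod_cast Finset.card_image_le
  -- One `N` pays for passing from `ν` to `α` at scale `M`, the other for returning from `α` to `ν`
  -- at scale `1`.
  set A : ℝ≥0∞ := discreteEntropy ν (fun y => ⌊y⌋) + N + N with hA
  have hAtop : A ≠ ∞ := by simp [hA, hH]
  have hT : ∀ M : ℕ, Measurable fun y : ℝ => ⌊(M : ℝ) * y⌋ := fun M =>
    Int.measurable_floor.comp (measurable_const_mul _)
  have hupper : ∀ M : ℕ, M ≠ 0 → discreteEntropy ν (fun y => ⌊(M : ℝ) * y⌋) ≤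
      A + ENNReal.ofReal (ν.real Qᶜ * Real.log M) := by
    intro M hM
    have h1 := discreteEntropy_le_add_card ν α _ _ (hcell _ (hT M))
    have h2 := discreteEntropy_floor_mul_le α hα1 hM
    have h3 := discreteEntropy_le_add_card α ν _ _
      (fun j hj => (hcell _ Int.measurable_floor j hj).symm)
    rw [hαr] at h2
    calc _ ≤ _ := h1
      _ ≤ (discreteEntropy ν (fun y => ⌊y⌋) + N + ENNReal.ofReal (ν.real Qᶜ * Real.log M)) + N := by
        refine add_le_add (h2.trans (add_le_add (h3.trans ?_) le_rfl)) (hcard _)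
        exact add_le_add le_rfl (hcard _)
      _ = _ := by rw [hA]; ring
  have hfin : ∀ M : ℕ, M ≠ 0 → discreteEntropy ν (fun y => ⌊(M : ℝ) * y⌋) ≠ ∞ := fun M hM =>
    ne_top_of_le_ne_top (by finiteness) (hupper M hM)
  refine ⟨hfin, ?_⟩
  have hlogtop : Tendsto (fun M : ℕ => Real.log M) atTop atTop :=
    Real.tendsto_log_atTop.comp tendsto_natCast_atTop_atTop
  have hd0 : 0 ≤ ν.real Qᶜ := measureReal_nonneg
  refine tendsto_order.2 ⟨fun a ha => ?_, fun b hb => ?_⟩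
  -- Half the gap, so that the limiting lower bound `ν.real Qᶜ - e` still exceeds `a`.
  · set e := (ν.real Qᶜ - a) / 2 with he
    have he0 : 0 < e := by rw [he]; linarith
    obtain ⟨δ, hδ, hs⟩ := exists_pos_measure_lt_of_absolutelyContinuous hac
      (ε := ENNReal.ofReal e) (by simpa using he0)
    obtain ⟨C, hC0, hC⟩ : ∃ C : ℝ, 0 < C ∧ (ENNReal.ofReal C)⁻¹ < δ := by
      obtain ⟨n, hn⟩ := ENNReal.exists_inv_nat_lt hδ.ne'
      refine ⟨n + 1, by positivity, lt_of_le_of_lt ?_ hn⟩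
      rw [ENNReal.inv_le_inv, ← ENNReal.ofReal_natCast]
      exact ENNReal.ofReal_le_ofReal (by linarith)
    have hlow : ∀ᶠ M : ℕ in atTop, (1 - Real.log C / Real.log M) *
        (ν.real Qᶜ - e - N * (C / M)) ≤
        (discreteEntropy ν (fun y => ⌊(M : ℝ) * y⌋)).toReal / Real.log M := by
      filter_upwards [eventually_ge_atTop (⌈C⌉₊), eventually_gt_atTop 1] with M hM hM1
      have hCM : C ≤ M := Nat.ceil_le.1 hM
      have hM0 : (0 : ℝ) < M := hC0.trans_le hCM
      have hlM : 0 < Real.log M := Real.log_pos (by exact_mod_cast hM1)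
      have hl0 : 0 ≤ Real.log (M / C) := Real.log_nonneg (by rwa [one_le_div hC0])
      have h := log_mul_measure_univ_le ν α hα1 hC0 hCM _ (hcell _ (hT M))
        (ε := ENNReal.ofReal e) (fun s hs' => (hs s (hs'.trans_lt hC)).le)
      have h' := h.trans (add_le_add le_rfl (mul_le_mul_right (add_le_add le_rfl
        (mul_le_mul_left (hcard _) _)) _))
      have h'' := ENNReal.toReal_mono (by
        have := hfin M (by omega)
        finiteness) h'
      rw [ENNReal.toReal_add (hfin M (by omega)) (by finiteness), ENNReal.toReal_mul,
        ENNReal.toReal_mul, ENNReal.toReal_add (by finiteness) (by finiteness),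
        ENNReal.toReal_mul, ENNReal.toReal_ofReal hl0, ENNReal.toReal_ofReal he0.le,
        ENNReal.toReal_ofReal (by positivity), ENNReal.toReal_natCast] at h''
      rw [← measureReal_def, hαr] at h''
      rw [le_div_iff₀ hlM]
      have heq : (1 - Real.log C / Real.log M) * Real.log M = Real.log (M / C) := by
        rw [Real.log_div hM0.ne' hC0.ne']; field_simp
      rw [mul_right_comm, heq]
      linarith
    have hlim : Tendsto (fun M : ℕ => (1 - Real.log C / Real.log M) *
        (ν.real Qᶜ - e - N * (C / M))) atTop (𝓝 ((1 - 0) * (ν.real Qᶜ - e - N * 0))) := by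
      refine (tendsto_const_nhds.sub (hlogtop.const_div_atTop _)).mul
        (tendsto_const_nhds.sub (tendsto_const_nhds.mul ?_))
      exact tendsto_natCast_atTop_atTop.const_div_atTop C
    have := hlim.eventually_const_lt (u := a) (by rw [he]; linarith)
    filter_upwards [this, hlow] with M h1 h2
    exact h1.trans_le h2
  · have hup : ∀ᶠ M : ℕ in atTop, (discreteEntropy ν (fun y => ⌊(M : ℝ) * y⌋)).toReal /
        Real.log M ≤ A.toReal / Real.log M + ν.real Qᶜ := by
      filter_upwards [eventually_gt_atTop 1] with M hM1
      have hlM : 0 < Real.log M := Real.log_pos (by exact_mod_cast hM1)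
      have h := ENNReal.toReal_mono (by finiteness) (hupper M (by omega))
      rw [ENNReal.toReal_add hAtop (by finiteness),
        ENNReal.toReal_ofReal (mul_nonneg hd0 hlM.le)] at h
      rw [div_le_iff₀ hlM, add_mul, div_mul_cancel₀ _ hlM.ne']
      exact h
    have hlim : Tendsto (fun M : ℕ => A.toReal / Real.log M + ν.real Qᶜ) atTop
        (𝓝 (0 + ν.real Qᶜ)) := (hlogtop.const_div_atTop _).add tendsto_const_nhds
    rw [zero_add] at hlim
    filter_upwards [hlim.eventually_lt_const hb, hup] with M h1 h2
    exact h2.trans_lt h1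

/-! ### The conditional MMSE as a minimum over estimators. -/

theorem integral_sq_gaussianReal : ∫ x, x ^ 2 ∂(gaussianReal 0 1) = 1 := by
  have h := variance_id_gaussianReal (μ := 0) (v := 1)
  rw [variance_eq_sub (memLp_id_gaussianReal 2)] at h
  simpa using h

theorem integrable_sq_gaussianReal : Integrable (fun x : ℝ => x ^ 2) (gaussianReal 0 1) :=
  (memLp_id_gaussianReal 2).integrable_sq

theorem lintegral_sq_gaussianReal :
    ∫⁻ x, ENNReal.ofReal (x ^ 2) ∂(gaussianReal 0 1) = 1 := by
  rw [← ofReal_integral_eq_lintegral_ofReal integrable_sq_gaussianReal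
    (Eventually.of_forall fun x => sq_nonneg x), integral_sq_gaussianReal, ENNReal.ofReal_one]

/-- Conditional expectation minimizes the mean square error. -/
theorem integral_sub_condExp_sq_le {Ω : Type*} {m m₀ : MeasurableSpace Ω} {P : Measure Ω}
    [IsFiniteMeasure P] (hm : m ≤ m₀) {X g : Ω → ℝ} (hX : MemLp X 2 P)
    (hg : StronglyMeasurable[m] g) (hXg : MemLp (X - g) 2 P) :
    ∫ ω, (X ω - (P[X | m]) ω) ^ 2 ∂P ≤ ∫ ω, (X ω - g ω) ^ 2 ∂P := by
  have hgL : MemLp g 2 P := by simpa using hX.sub hXg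
  have hXi := hX.integrable one_le_two
  have hgi := hgL.integrable one_le_two
  have hcg : P[g | m] = g := condExp_of_stronglyMeasurable hm hg hgi
  -- Subtracting the `m`-measurable `g` does not change the residual, so the left side is the
  -- integrated conditional variance of `X - g`, which its conditional second moment dominates.
  have hsub : (X - g) - P[X - g | m] =ᵐ[P] X - P[X | m] := by
    filter_upwards [condExp_sub hXi hgi m] with ω hω
    simp only [Pi.sub_apply] at hω ⊢
    rw [hω, hcg]; ring
  have hint : Integrable (((X - g) - P[X - g | m]) ^ 2) P :=
    (hXg.sub (hXg.condExp one_le_two)).integrable_sq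
  calc ∫ ω, (X ω - (P[X | m]) ω) ^ 2 ∂P
      = ∫ ω, (((X - g) - P[X - g | m]) ^ 2) ω ∂P := by
        refine integral_congr_ae ?_
        filter_upwards [hsub] with ω hω
        simp only [Pi.pow_apply, hω]
        rfl
    _ = ∫ ω, (condVar m (X - g) P) ω ∂P := (integral_condExp hm).symm
    _ ≤ ∫ ω, (P[(X - g) ^ 2 | m]) ω ∂P :=
        integral_mono_ae integrable_condVar integrable_condExp (condVar_ae_le_condExp_sq hm hXg)
    _ = ∫ ω, (X ω - g ω) ^ 2 ∂P := integral_condExp hm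

section Channel

variable {Ω β : Type*} [MeasurableSpace Ω] [MeasurableSpace β] {P : Measure Ω}
  {Z : Ω → ℝ} {U : Ω → β}

theorem measurable_observation (hZ : Measurable Z) (hU : Measurable U) (s : ℝ) :
    Measurable fun q : Ω × ℝ => (√s * Z q.1 + q.2, U q.1) := by fun_prop

theorem condMMSE_le [IsProbabilityMeasure P] (hZ : Measurable Z) (hU : Measurable U) (hZ2 : MemLp Z 2 P) (s : ℝ)
    {g : ℝ × β → ℝ} (hg : Measurable g)
    (hL : MemLp (fun q : Ω × ℝ => Z q.1 - g (√s * Z q.1 + q.2, U q.1)) 2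
      (P.prod (gaussianReal 0 1))) :
    condMMSE P Z U s ≤
      ∫ q : Ω × ℝ, (Z q.1 - g (√s * Z q.1 + q.2, U q.1)) ^ 2 ∂(P.prod (gaussianReal 0 1)) := by
  have hobs := measurable_observation hZ hU s
  refine integral_sub_condExp_sq_le (X := fun q : Ω × ℝ => Z q.1)
    (g := fun q : Ω × ℝ => g (√s * Z q.1 + q.2, U q.1)) hobs.comap_le ?_ ?_ hL
  · exact hZ2.comp_fst _
  · exact (hg.comp (comap_measurable _)).stronglyMeasurable

/-- The conditional expectation factors through the observation (Doob–Dynkin), so a lower bound need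
only treat measurable functions of the observation. -/
theorem exists_condMMSE_eq (hZ : Measurable Z) (hU : Measurable U) (hZ2 : MemLp Z 2 P) (s : ℝ) :
    ∃ g : ℝ × β → ℝ, Measurable g ∧
      ENNReal.ofReal (condMMSE P Z U s) =
        ∫⁻ q : Ω × ℝ, ENNReal.ofReal ((Z q.1 - g (√s * Z q.1 + q.2, U q.1)) ^ 2)
          ∂(P.prod (gaussianReal 0 1)) := by
  have hobs := measurable_observation hZ hU s
  obtain ⟨g, hg, hgeq⟩ := (stronglyMeasurable_condExp
    (m := MeasurableSpace.comap (fun q : Ω × ℝ => (√s * Z q.1 + q.2, U q.1)) inferInstance)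
    (f := fun q : Ω × ℝ => Z q.1)
    (μ := P.prod (gaussianReal 0 1))).measurable.exists_eq_measurable_comp
  refine ⟨g, hg, ?_⟩
  have hL : MemLp (fun q : Ω × ℝ => Z q.1) 2 (P.prod (gaussianReal 0 1)) := hZ2.comp_fst _
  have hi := (hL.sub (hL.condExp one_le_two
    (m := MeasurableSpace.comap (fun q : Ω × ℝ => (√s * Z q.1 + q.2, U q.1))
      inferInstance))).integrable_sq
  rw [hgeq] at hi
  rw [condMMSE, hgeq]
  exact ofReal_integral_eq_lintegral_ofReal hi (Eventually.of_forall fun x => sq_nonneg _)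

end Channel

/-! ### Upper bound: the nearest-candidate estimator. -/

theorem IsSmoothPartition.exists_measurable_leftInverse {f : ℝ → ℝ} {K : ℕ} {I : Fin K → Set ℝ}
    (h : IsSmoothPartition f I) (k : Fin K) :
    ∃ g : ℝ → ℝ, Measurable g ∧ (Set.InjOn f (I k) → ∀ z ∈ I k, g (f z) = z) := by
  by_cases hinj : Set.InjOn f (I k)
  · have hemb := (h.contDiffOn k).continuousOn.measurableEmbedding
      (h.ordConnected k).measurableSet hinj
    obtain ⟨g, hg, hgf⟩ := hemb.exists_measurable_extend
      (g := fun z : I k => (z : ℝ)) measurable_subtype_coe (fun _ => ⟨0⟩)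
    exact ⟨g, hg, fun _ z hz => congrFun hgf ⟨z, hz⟩⟩
  · exact ⟨0, measurable_const, fun h' => (hinj h').elim⟩

/-- Measurable selection of a candidate nearest to `x`, among `0` and the values `h k y`. -/
theorem exists_measurable_nearest {ι : Type*} (h : ι → ℝ → ℝ) (hh : ∀ k, Measurable (h k))
    (s : Finset ι) :
    ∃ g : ℝ × ℝ → ℝ, Measurable g ∧ ∀ x y, (∀ k ∈ s, |x - g (x, y)| ≤ |x - h k y|) ∧
      (g (x, y) = 0 ∨ ∃ k, g (x, y) = h k y) := by
  classical
  induction s using Finset.induction_on with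
  | empty => exact ⟨0, measurable_const, by simp⟩
  | insert k s _ ih =>
    obtain ⟨g, hg, hp⟩ := ih
    refine ⟨fun p => if |p.1 - g p| ≤ |p.1 - h k p.2| then g p else h k p.2, ?_, fun x y => ?_⟩
    · have := hh k
      exact Measurable.ite (measurableSet_le (by fun_prop) (by fun_prop)) hg (by fun_prop)
    · obtain ⟨h1, h2⟩ := hp x y
      dsimp only
      split_ifs with hc
      · refine ⟨fun j hj => ?_, h2⟩
        rcases Finset.mem_insert.1 hj with rfl | hj
        · exact hc
        · exact h1 j hj
      · refine ⟨fun j hj => ?_, Or.inr ⟨k, rfl⟩⟩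
        rcases Finset.mem_insert.1 hj with rfl | hj
        · exact le_rfl
        · exact (not_le.1 hc).le.trans (h1 j hj)

/-- There is an estimator of `z` from a noisy version `x` and `f z` that errs by at most twice the
noise, and recovers `z` exactly for small noise. -/
theorem IsSmoothPartition.exists_estimator {f : ℝ → ℝ} {K : ℕ} {I : Fin K → Set ℝ}
    (h : IsSmoothPartition f I) :
    ∃ g : ℝ × ℝ → ℝ, Measurable g ∧ ∀ k, Set.InjOn f (I k) → ∀ z ∈ I k,
      (∀ x, |z - g (x, f z)| ≤ 2 * |x - z|) ∧ ∀ᶠ x in 𝓝 z, g (x, f z) = z := by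
  choose e he hinv using h.exists_measurable_leftInverse
  obtain ⟨g, hg, hp⟩ := exists_measurable_nearest e he Finset.univ
  refine ⟨g, hg, fun k hk z hz => ?_⟩
  have hbound : ∀ x, |z - g (x, f z)| ≤ 2 * |x - z| := by
    intro x
    have h1 := (hp x (f z)).1 k (Finset.mem_univ k)
    rw [hinv k hk z hz] at h1
    calc |z - g (x, f z)| = |(z - x) + (x - g (x, f z))| := by ring_nf
      _ ≤ |z - x| + |x - g (x, f z)| := abs_add_le _ _
      _ ≤ 2 * |x - z| := by rw [abs_sub_comm z x]; linarith
  refine ⟨hbound, ?_⟩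
  have hlim : Tendsto (fun x => g (x, f z)) (𝓝 z) (𝓝 z) := by
    rw [tendsto_iff_dist_tendsto_zero]
    refine squeeze_zero (g := fun x => 2 * |x - z|) (fun _ => dist_nonneg) (fun x => ?_) ?_
    · rw [dist_comm, Real.dist_eq]; exact hbound x
    · have : Continuous fun x : ℝ => 2 * |x - z| := by fun_prop
      simpa using this.tendsto z
  -- With `f z` fixed the estimate lies in this finite set (`0` is the default of the selection),
  -- and it converges to `z`; hence it eventually equals `z`.
  set F : Set ℝ := insert 0 (Set.range fun j => e j (f z)) with hF
  have hfin : (F \ {z}).Finite := ((Set.finite_range _).insert 0).subset Set.sdiff_subset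
  filter_upwards [hlim.eventually (hfin.isClosed.isOpen_compl.mem_nhds (x := z) (by simp))]
    with x hx
  by_contra hne
  refine hx ⟨?_, hne⟩
  rcases (hp x (f z)).2 with h0 | ⟨j, hj⟩
  · exact Or.inl h0
  · exact Or.inr ⟨j, hj.symm⟩

theorem ae_of_map_eq_gaussianReal {Ω : Type*} [MeasurableSpace Ω] {P : Measure Ω}
    {Z : Ω → ℝ} (hZ : Measurable Z) (hZlaw : P.map Z = gaussianReal 0 1) {p : ℝ → Prop}
    (hp : ∀ᵐ z : ℝ, p z) : ∀ᵐ ω ∂P, p (Z ω) := by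
  refine ae_of_ae_map hZ.aemeasurable ?_
  rw [hZlaw]
  exact (gaussianReal_absolutelyContinuous 0 one_ne_zero).ae_le hp

theorem memLp_of_map_eq_gaussianReal {Ω : Type*} [MeasurableSpace Ω] {P : Measure Ω}
    {Z : Ω → ℝ} (hZ : Measurable Z) (hZlaw : P.map Z = gaussianReal 0 1) : MemLp Z 2 P := by
  have h := memLp_id_gaussianReal (μ := 0) (v := 1) 2
  rw [← hZlaw, ENNReal.coe_ofNat,
    memLp_map_measure_iff measurable_id.aestronglyMeasurable hZ.aemeasurable] at h
  exact h

/-- The scaled conditional MMSE is asymptotically at most the probability of a flat value. -/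
theorem IsSmoothPartition.eventually_mul_condMMSE_lt {Ω : Type*} [MeasurableSpace Ω]
    {P : Measure Ω} [IsProbabilityMeasure P] {Z : Ω → ℝ} (hZ : Measurable Z)
    (hZlaw : P.map Z = gaussianReal 0 1) {f : ℝ → ℝ} {K : ℕ} {I : Fin K → Set ℝ}
    (h : IsSmoothPartition f I) {b : ℝ} (hb : P.real {ω | f (Z ω) ∈ flatValues f} < b) :
    ∀ᶠ s : ℝ in atTop, s * condMMSE P Z (fun ω => f (Z ω)) s < b := by
  classical
  obtain ⟨g, hg, hgp⟩ := h.exists_estimator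
  have hQm : MeasurableSet (flatValues f) := h.finite_flatValues.measurableSet
  have hfm := h.measurable
  set γ := gaussianReal 0 1 with hγ
  -- At a flat value the rescaled observation itself is the estimate; elsewhere the nearest
  -- candidate is.
  let G : ℝ → ℝ × ℝ → ℝ := fun s p => if p.2 ∈ flatValues f then p.1 / √s else g (p.1 / √s, p.2)
  have hG : ∀ s, Measurable (G s) := fun s =>
    Measurable.ite (measurable_snd hQm) (by fun_prop) (by fun_prop)
  let E : ℝ → Ω × ℝ → ℝ := fun s q => Z q.1 - G s (√s * Z q.1 + q.2, f (Z q.1))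
  have hEm : ∀ s, Measurable (E s) := fun s => by
    have := hG s
    fun_prop
  let L : Ω × ℝ → ℝ := fun q =>
    {ω | f (Z ω) ∈ flatValues f}.indicator (fun _ => (1 : ℝ)) q.1 * q.2 ^ 2
  have hpt : ∀ᵐ ω ∂P, (f (Z ω) ∈ flatValues f ∨ (f (Z ω) ∉ flatValues f ∧
      (∀ x, |Z ω - g (x, f (Z ω))| ≤ 2 * |x - Z ω|) ∧
        ∀ᶠ x in 𝓝 (Z ω), g (x, f (Z ω)) = Z ω)) := by
    refine ae_of_map_eq_gaussianReal hZ hZlaw (p := fun z => (f z ∈ flatValues f ∨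
      (f z ∉ flatValues f ∧ (∀ x, |z - g (x, f z)| ≤ 2 * |x - z|) ∧
        ∀ᶠ x in 𝓝 z, g (x, f z) = z))) ?_
    filter_upwards [h.ae_flat_or_injOn] with z hz
    rcases hz with hz | ⟨h1, -, k, hk, hz⟩
    · exact Or.inl hz.1
    · exact Or.inr ⟨h1, hgp k hk z (interior_subset hz)⟩
  have hpt' : ∀ᵐ q ∂(P.prod γ), (f (Z q.1) ∈ flatValues f ∨ (f (Z q.1) ∉ flatValues f ∧
      (∀ x, |Z q.1 - g (x, f (Z q.1))| ≤ 2 * |x - Z q.1|) ∧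
        ∀ᶠ x in 𝓝 (Z q.1), g (x, f (Z q.1)) = Z q.1)) :=
    Measure.quasiMeasurePreserving_fst.ae hpt
  have hobs : ∀ s : ℝ, 0 < s → ∀ z n : ℝ, (√s * z + n) / √s = z + n / √s := by
    intro s hs z n
    have := (Real.sqrt_pos.2 hs).ne'
    field_simp
  have hbound : ∀ s : ℝ, 0 < s → ∀ᵐ q ∂(P.prod γ), |E s q| ≤ 2 * |q.2| / √s := by
    intro s hs
    have hsq := Real.sqrt_pos.2 hs
    filter_upwards [hpt'] with q hq
    have habs : |q.2 / √s| = |q.2| / √s := by rw [abs_div, abs_of_pos hsq]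
    rcases hq with hq | ⟨hq, hb1, -⟩
    · simp only [E, G, if_pos hq, hobs s hs]
      rw [sub_add_cancel_left, abs_neg, habs]
      gcongr
      linarith [abs_nonneg q.2]
    · simp only [E, G, if_neg hq, hobs s hs]
      refine (hb1 _).trans_eq ?_
      rw [add_sub_cancel_left, habs]; ring
  have hn2 : MemLp (fun q : Ω × ℝ => q.2) 2 (P.prod γ) := by
    have : MemLp (fun n : ℝ => n) 2 γ :=
      memLp_id_gaussianReal' 2 ENNReal.ofNat_ne_top
    exact this.comp_snd _
  have hEL : ∀ s : ℝ, 0 < s → MemLp (E s) 2 (P.prod γ) := by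
    intro s hs
    refine (hn2.norm.const_mul (2 / √s)).mono (hEm s).aestronglyMeasurable ?_
    filter_upwards [hbound s hs] with q hq
    rw [Real.norm_eq_abs]
    refine hq.trans ((le_abs_self _).trans_eq ?_)
    rw [Real.norm_eq_abs, Real.norm_eq_abs]
    congr 1; ring
  have hlim : Tendsto (fun s : ℝ => ∫ q, s * E s q ^ 2 ∂(P.prod γ)) atTop
      (𝓝 (∫ q, L q ∂(P.prod γ))) := by
    -- For `s > 0` the error is at most `2|n| / √s`, whence the dominating function. Pointwise, the
    -- integrand is `n²` at flat values and eventually `0` elsewhere.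
    refine tendsto_integral_filter_of_dominated_convergence (fun q => 4 * q.2 ^ 2) ?_ ?_ ?_ ?_
    · exact Eventually.of_forall fun s =>
        (((hEm s).pow_const 2).const_mul s).aestronglyMeasurable
    · filter_upwards [eventually_gt_atTop 0] with s hs
      filter_upwards [hbound s hs] with q hq
      rw [Real.norm_eq_abs, abs_of_nonneg (mul_nonneg hs.le (sq_nonneg _)), ← sq_abs (E s q)]
      calc s * |E s q| ^ 2 ≤ s * (2 * |q.2| / √s) ^ 2 := by gcongr
        _ = 4 * q.2 ^ 2 := by
          rw [div_pow, Real.sq_sqrt hs.le, mul_pow, sq_abs]; field_simp; ring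
    · exact (hn2.integrable_sq).const_mul 4
    · filter_upwards [hpt'] with q hq
      rcases hq with hq | ⟨hq, -, hb2⟩
      · refine tendsto_const_nhds.congr' ?_
        filter_upwards [eventually_gt_atTop 0] with s hs
        have hmem : q.1 ∈ {ω | f (Z ω) ∈ flatValues f} := hq
        simp only [E, G, L, if_pos hq, hobs s hs, Set.indicator_of_mem hmem]
        rw [sub_add_cancel_left, neg_sq, div_pow, Real.sq_sqrt hs.le]
        field_simp
      · have hmem : q.1 ∉ {ω | f (Z ω) ∈ flatValues f} := hq
        refine tendsto_const_nhds.congr' ?_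
        have hx : Tendsto (fun s : ℝ => Z q.1 + q.2 / √s) atTop (𝓝 (Z q.1)) := by
          have := (Real.tendsto_sqrt_atTop.const_div_atTop q.2).const_add (Z q.1)
          simpa using this
        filter_upwards [eventually_gt_atTop 0, hx.eventually hb2] with s hs hgs
        simp only [E, G, L, if_neg hq, hobs s hs, Set.indicator_of_notMem hmem, hgs]
        simp
  have hL : ∫ q, L q ∂(P.prod γ) = P.real {ω | f (Z ω) ∈ flatValues f} := by
    have hset : MeasurableSet {ω | f (Z ω) ∈ flatValues f} := (hfm.comp hZ) hQm
    simp only [L]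
    rw [integral_prod_mul ({ω | f (Z ω) ∈ flatValues f}.indicator (fun _ => (1 : ℝ)))
      (fun n : ℝ => n ^ 2), integral_sq_gaussianReal, mul_one]
    exact integral_indicator_one hset
  rw [hL] at hlim
  filter_upwards [hlim.eventually_lt_const hb, eventually_gt_atTop 0] with s h1 hs
  refine lt_of_le_of_lt ?_ h1
  rw [integral_const_mul]
  exact mul_le_mul_of_nonneg_left (condMMSE_le hZ (hfm.comp hZ)
    (memLp_of_map_eq_gaussianReal hZ hZlaw) s (hG s) (hEL s hs)) hs.le

/-! ### Lower bound: symmetrization and Fatou's lemma. -/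

/-- For an even weight, the best constant predictor of the identity is `0`. -/
theorem lintegral_even_mul_sq_le {E : ℝ → ℝ≥0∞} (hE : Measurable E) (heven : ∀ n, E (-n) = E n)
    (c : ℝ) :
    ∫⁻ n, E n * ENNReal.ofReal (n ^ 2) ≤ ∫⁻ n, E n * ENNReal.ofReal ((c - n) ^ 2) := by
  have hflip : ∫⁻ n, E n * ENNReal.ofReal ((c + n) ^ 2) =
      ∫⁻ n, E n * ENNReal.ofReal ((c - n) ^ 2) := by
    rw [← lintegral_neg_eq_self]
    simp [heven, sub_eq_add_neg]
  have h2 : 2 * ∫⁻ n, E n * ENNReal.ofReal (n ^ 2) ≤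
      2 * ∫⁻ n, E n * ENNReal.ofReal ((c - n) ^ 2) := by
    calc 2 * ∫⁻ n, E n * ENNReal.ofReal (n ^ 2)
        = ∫⁻ n, 2 * (E n * ENNReal.ofReal (n ^ 2)) :=
          (lintegral_const_mul _ (by fun_prop)).symm
      _ ≤ ∫⁻ n, (E n * ENNReal.ofReal ((c - n) ^ 2) + E n * ENNReal.ofReal ((c + n) ^ 2)) := by
          refine lintegral_mono fun n => ?_
          -- This rests on `(c - n)² + (c + n)² = 2c² + 2n²`.
          rw [← mul_add, ← ENNReal.ofReal_add (sq_nonneg _) (sq_nonneg _), mul_left_comm]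
          refine mul_le_mul_right ?_ _
          rw [← ENNReal.ofReal_ofNat, ← ENNReal.ofReal_mul (by norm_num)]
          exact ENNReal.ofReal_le_ofReal (by nlinarith [sq_nonneg c])
      _ = 2 * ∫⁻ n, E n * ENNReal.ofReal ((c - n) ^ 2) := by
          rw [lintegral_add_left (by fun_prop), hflip, two_mul]
  exact (ENNReal.mul_le_mul_iff_right (by norm_num) (by norm_num)).1 h2

/-- The symmetrized prior density on an open set `A` at scale `1 / √s` around `p.1`. -/
noncomputable def symmWeight (A : Set ℝ) (s : ℝ) (p : ℝ × ℝ) : ℝ≥0∞ :=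
  -- The minimum is even in `p.2`. The outer indicator makes the weight vanish for `p.1` outside
  -- `A`, including boundary points, where convergence would otherwise be in doubt.
  A.indicator (fun x => min (A.indicator (gaussianPDF 0 1) (x - p.2 / √s))
    (A.indicator (gaussianPDF 0 1) (x + p.2 / √s))) p.1

theorem measurable_symmWeight {A : Set ℝ} (hA : MeasurableSet A) (s : ℝ) :
    Measurable (symmWeight A s) := by
  have hw : Measurable (A.indicator (gaussianPDF 0 1)) :=
    (measurable_gaussianPDF 0 1).indicator hA
  have : symmWeight A s = (Prod.fst ⁻¹' A).indicator (fun p : ℝ × ℝ =>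
      min (A.indicator (gaussianPDF 0 1) (p.1 - p.2 / √s))
        (A.indicator (gaussianPDF 0 1) (p.1 + p.2 / √s))) := by
    ext p
    by_cases hp : p.1 ∈ A <;> simp [symmWeight, hp]
  rw [this]
  exact Measurable.indicator (by fun_prop) (measurable_fst hA)

theorem symmWeight_neg (A : Set ℝ) (s x n : ℝ) : symmWeight A s (x, -n) = symmWeight A s (x, n) := by
  simp only [symmWeight, neg_div, sub_neg_eq_add, ← sub_eq_add_neg]
  congr 1
  ext y
  rw [min_comm]

theorem symmWeight_le (A : Set ℝ) (s x n : ℝ) :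
    symmWeight A s (x, n) ≤ A.indicator (gaussianPDF 0 1) (x - n / √s) := by
  rw [symmWeight]
  by_cases hx : x ∈ A
  · simp only [Set.indicator_of_mem hx]; exact min_le_left _ _
  · simp [hx]

theorem continuous_gaussianPDF (μ : ℝ) (v : NNReal) : Continuous (gaussianPDF μ v) := by
  unfold gaussianPDF gaussianPDFReal
  exact ENNReal.continuous_ofReal.comp (by fun_prop)

theorem tendsto_symmWeight {A : Set ℝ} (hA : IsOpen A) (p : ℝ × ℝ) :
    Tendsto (fun s => symmWeight A s p) atTop (𝓝 (A.indicator (gaussianPDF 0 1) p.1)) := by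
  by_cases hx : p.1 ∈ A
  · have hc : ContinuousAt (A.indicator (gaussianPDF 0 1)) p.1 :=
      (continuous_gaussianPDF 0 1).continuousAt.congr
        (by filter_upwards [hA.mem_nhds hx] with y hy; simp [hy])
    have h0 : Tendsto (fun s : ℝ => p.2 / √s) atTop (𝓝 0) :=
      Real.tendsto_sqrt_atTop.const_div_atTop p.2
    have h1 : Tendsto (fun s : ℝ => p.1 - p.2 / √s) atTop (𝓝 p.1) := by
      simpa using tendsto_const_nhds.sub h0
    have h2 : Tendsto (fun s : ℝ => p.1 + p.2 / √s) atTop (𝓝 p.1) := by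
      simpa using tendsto_const_nhds.add h0
    have := (hc.tendsto.comp h1).min (hc.tendsto.comp h2)
    rw [min_self] at this
    simpa [symmWeight, hx, Function.comp_def] using this
  · simp [symmWeight, hx]

/-- Lower bound for the scaled error of any estimator on the event that the prior variable lies
in `A`. -/
theorem lintegral_symmWeight_le {A : Set ℝ} (hA : MeasurableSet A) {s : ℝ} (hs : 0 < s)
    {c : ℝ → ℝ} (hc : Measurable c) :
    ∫⁻ p : ℝ × ℝ, symmWeight A s p * (gaussianPDF 0 1 p.2 * ENNReal.ofReal (p.2 ^ 2)) ≤
      ∫⁻ z, ∫⁻ n, A.indicator (fun z => ENNReal.ofReal (s * (z - c (√s * z + n)) ^ 2)) z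
        ∂(gaussianReal 0 1) ∂(gaussianReal 0 1) := by
  have hsq := Real.sqrt_pos.2 hs
  have hφ := measurable_gaussianPDF 0 1
  have hw : Measurable (A.indicator (gaussianPDF 0 1)) := hφ.indicator hA
  have hW := measurable_symmWeight hA s
  set k : ℝ → ℝ := fun x => √s * (x - c (√s * x)) with hk
  have hkm : Measurable k := by fun_prop
  have hind : ∀ z n, A.indicator (fun z => ENNReal.ofReal (s * (z - c (√s * z + n)) ^ 2)) z =
      A.indicator 1 z * ENNReal.ofReal (s * (z - c (√s * z + n)) ^ 2) := by
    intro z n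
    by_cases hz : z ∈ A <;> simp [hz]
  have h1m : Measurable (A.indicator (1 : ℝ → ℝ≥0∞)) := measurable_one.indicator hA
  have hright : ∫⁻ z, ∫⁻ n, A.indicator (fun z => ENNReal.ofReal (s * (z - c (√s * z + n)) ^ 2)) z
        ∂(gaussianReal 0 1) ∂(gaussianReal 0 1) =
      ∫⁻ x, ∫⁻ n, (A.indicator (gaussianPDF 0 1) (x - n / √s) * gaussianPDF 0 1 n) *
        ENNReal.ofReal ((k x - n) ^ 2) := by
    simp_rw [hind]
    rw [gaussianReal_of_var_ne_zero _ one_ne_zero,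
      lintegral_withDensity_eq_lintegral_mul _ hφ (Measurable.lintegral_prod_right' (f := fun p : ℝ × ℝ =>
        A.indicator 1 p.1 * ENNReal.ofReal (s * (p.1 - c (√s * p.1 + p.2)) ^ 2)) (by fun_prop))]
    calc _ = ∫⁻ z, ∫⁻ n, (A.indicator (gaussianPDF 0 1) z * gaussianPDF 0 1 n) *
          ENNReal.ofReal (s * (z - c (√s * z + n)) ^ 2) := by
          refine lintegral_congr fun z => ?_
          rw [Pi.mul_apply, lintegral_withDensity_eq_lintegral_mul _ hφ (by fun_prop),
            ← lintegral_const_mul _ (by fun_prop)]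
          refine lintegral_congr fun n => ?_
          rw [Pi.mul_apply]
          by_cases hz : z ∈ A <;> simp [hz, mul_assoc]
      _ = ∫⁻ n, ∫⁻ z, (A.indicator (gaussianPDF 0 1) z * gaussianPDF 0 1 n) *
          ENNReal.ofReal (s * (z - c (√s * z + n)) ^ 2) :=
          lintegral_lintegral_swap (by fun_prop)
      _ = ∫⁻ n, ∫⁻ x, (A.indicator (gaussianPDF 0 1) (x - n / √s) * gaussianPDF 0 1 n) *
          ENNReal.ofReal ((k x - n) ^ 2) := by
          refine lintegral_congr fun n => ?_
          -- The translation `z = x - n / √s` turns the observation into `√s x`, so the estimator no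
          -- longer sees `n`.
          rw [← lintegral_sub_right_eq_self _ (n / √s)]
          refine lintegral_congr fun x => ?_
          have e1 : √s * (x - n / √s) + n = √s * x := by field_simp; ring
          rw [e1]
          congr 2
          rw [hk]
          have e2 : √s * (x - c (√s * x)) - n = √s * (x - n / √s - c (√s * x)) := by
            field_simp; ring
          simp only [e2, mul_pow, Real.sq_sqrt hs.le]
      _ = _ := lintegral_lintegral_swap (by fun_prop)
  rw [hright, Measure.volume_eq_prod, lintegral_prod _ (by fun_prop)]
  refine lintegral_mono fun x => ?_
  calc ∫⁻ n, symmWeight A s (x, n) * (gaussianPDF 0 1 n * ENNReal.ofReal (n ^ 2))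
      = ∫⁻ n, (symmWeight A s (x, n) * gaussianPDF 0 1 n) * ENNReal.ofReal (n ^ 2) := by
        simp_rw [mul_assoc]
    _ ≤ ∫⁻ n, (symmWeight A s (x, n) * gaussianPDF 0 1 n) * ENNReal.ofReal ((k x - n) ^ 2) := by
        refine lintegral_even_mul_sq_le (by fun_prop) (fun n => ?_) _
        rw [symmWeight_neg]
        congr 1
        simp [gaussianPDF, gaussianPDFReal]
    _ ≤ _ := by
        refine lintegral_mono fun n => ?_
        gcongr
        exact symmWeight_le A s x n

/-- Asymptotically, the lower bound captures the whole mass of finitely many open sets. -/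
theorem sum_gaussianReal_le_liminf {ι : Type*} (t : Finset ι) {A : ι → Set ℝ}
    (hA : ∀ y, IsOpen (A y)) {s : ℕ → ℝ} (hs : Tendsto s atTop atTop) :
    ∑ y ∈ t, gaussianReal 0 1 (A y) ≤ liminf (fun m => ∑ y ∈ t, ∫⁻ p : ℝ × ℝ,
      symmWeight (A y) (s m) p * (gaussianPDF 0 1 p.2 * ENNReal.ofReal (p.2 ^ 2))) atTop := by
  have hφ := measurable_gaussianPDF 0 1
  have hm : ∀ y m, Measurable fun p : ℝ × ℝ =>
      symmWeight (A y) (s m) p * (gaussianPDF 0 1 p.2 * ENNReal.ofReal (p.2 ^ 2)) := fun y m => by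
    have := measurable_symmWeight (hA y).measurableSet (s m)
    fun_prop
  have hw : ∀ y, Measurable ((A y).indicator (gaussianPDF 0 1)) := fun y =>
    hφ.indicator (hA y).measurableSet
  have hmass : ∀ y, gaussianReal 0 1 (A y) = ∫⁻ p : ℝ × ℝ,
      (A y).indicator (gaussianPDF 0 1) p.1 *
        (gaussianPDF 0 1 p.2 * ENNReal.ofReal (p.2 ^ 2)) := by
    intro y
    have h1 := lintegral_sq_gaussianReal
    rw [gaussianReal_of_var_ne_zero _ one_ne_zero,
      lintegral_withDensity_eq_lintegral_mul _ hφ (by fun_prop)] at h1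
    simp only [Pi.mul_apply] at h1
    rw [Measure.volume_eq_prod, lintegral_prod_mul (g := fun n : ℝ => gaussianPDF 0 1 n *
      ENNReal.ofReal (n ^ 2)) (hw y).aemeasurable (by fun_prop), h1, mul_one,
      lintegral_indicator (hA y).measurableSet, gaussianReal_apply _ one_ne_zero]
  simp_rw [hmass]
  rw [← lintegral_finsetSum _ (fun y _ => by have := hw y; fun_prop)]
  simp_rw [← lintegral_finsetSum t (fun y _ => hm y _)]
  -- Fatou's lemma; the integrands converge pointwise because each `A y` is open and the Gaussian
  -- density is continuous.
  refine le_trans (le_of_eq (lintegral_congr fun p => ?_))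
    (lintegral_liminf_le fun m => Finset.measurable_fun_sum t fun y _ => hm y m)
  refine (Tendsto.liminf_eq (tendsto_finsetSum _ fun y _ => ?_)).symm
  refine ENNReal.Tendsto.mul_const ((tendsto_symmWeight (hA y) p).comp hs) (Or.inr ?_)
  simp [gaussianPDF, ENNReal.mul_eq_top]

/-- The scaled conditional MMSE is asymptotically at least the probability of a flat value. -/
theorem IsSmoothPartition.eventually_lt_mul_condMMSE {Ω : Type*} [MeasurableSpace Ω]
    {P : Measure Ω} [IsProbabilityMeasure P] {Z : Ω → ℝ} (hZ : Measurable Z)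
    (hZlaw : P.map Z = gaussianReal 0 1) {f : ℝ → ℝ} {K : ℕ} {I : Fin K → Set ℝ}
    (h : IsSmoothPartition f I) {a : ℝ} (ha : a < P.real {ω | f (Z ω) ∈ flatValues f}) :
    ∀ᶠ s : ℝ in atTop, a < s * condMMSE P Z (fun ω => f (Z ω)) s := by
  classical
  have hfm := h.measurable
  set t := h.finite_flatValues.toFinset with ht
  set A : ℝ → Set ℝ := fun y => interior (f ⁻¹' {y}) with hAdef
  have hA : ∀ y, IsOpen (A y) := fun y => isOpen_interior
  have hdisj : Pairwise (Function.onFun Disjoint A) := fun y y' hyy => by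
    refine Disjoint.mono interior_subset interior_subset ?_
    exact Disjoint.preimage _ (by simpa using hyy)
  have hmass : P {ω | f (Z ω) ∈ flatValues f} ≤ ∑ y ∈ t, gaussianReal 0 1 (A y) := by
    rw [← measure_biUnion_finset (fun y _ y' _ hyy => hdisj hyy) (fun y _ => (hA y).measurableSet),
      ← hZlaw, Measure.map_apply hZ (Finset.measurableSet_biUnion t fun y _ => (hA y).measurableSet)]
    refine measure_mono_ae ?_
    filter_upwards [ae_of_map_eq_gaussianReal hZ hZlaw h.ae_flat_or_injOn] with ω hω hmem
    rcases hω with hω | hω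
    · exact Set.mem_biUnion (show f (Z ω) ∈ t by simpa [ht] using hω.1) hω.2.2
    · exact (hω.1 hmem).elim
  have hlow : ∀ s : ℝ, 0 < s → ∑ y ∈ t, ∫⁻ p : ℝ × ℝ,
      symmWeight (A y) s p * (gaussianPDF 0 1 p.2 * ENNReal.ofReal (p.2 ^ 2)) ≤
      ENNReal.ofReal (s * condMMSE P Z (fun ω => f (Z ω)) s) := by
    intro s hs
    obtain ⟨g, hg, hgeq⟩ := exists_condMMSE_eq hZ (U := fun ω => f (Z ω)) (hfm.comp hZ)
      (memLp_of_map_eq_gaussianReal hZ hZlaw) s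
    have hF : ∀ y, Measurable fun p : ℝ × ℝ => (A y).indicator
        (fun z => ENNReal.ofReal (s * (z - g (√s * z + p.2, y)) ^ 2)) p.1 := fun y => by
      have : (fun p : ℝ × ℝ => (A y).indicator
        (fun z => ENNReal.ofReal (s * (z - g (√s * z + p.2, y)) ^ 2)) p.1) =
        (Prod.fst ⁻¹' A y).indicator
          (fun p : ℝ × ℝ => ENNReal.ofReal (s * (p.1 - g (√s * p.1 + p.2, y)) ^ 2)) := by
        ext p; simp [Set.indicator]
      rw [this]
      exact Measurable.indicator (by fun_prop) (measurable_fst (hA y).measurableSet)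
    calc _ ≤ ∑ y ∈ t, ∫⁻ z, ∫⁻ n, (A y).indicator
          (fun z => ENNReal.ofReal (s * (z - g (√s * z + n, y)) ^ 2)) z
            ∂(gaussianReal 0 1) ∂(gaussianReal 0 1) :=
          Finset.sum_le_sum fun y _ => lintegral_symmWeight_le (hA y).measurableSet hs
            (c := fun v => g (v, y)) (by fun_prop)
      _ = ∫⁻ z, ∑ y ∈ t, ∫⁻ n, (A y).indicator
          (fun z => ENNReal.ofReal (s * (z - g (√s * z + n, y)) ^ 2)) z
            ∂(gaussianReal 0 1) ∂(gaussianReal 0 1) :=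
          (lintegral_finsetSum t fun y _ => (hF y).lintegral_prod_right').symm
      _ ≤ ∫⁻ z, ∫⁻ n, ENNReal.ofReal (s * (z - g (√s * z + n, f z)) ^ 2)
            ∂(gaussianReal 0 1) ∂(gaussianReal 0 1) := by
          refine lintegral_mono fun z => ?_
          have hFz : ∀ y, Measurable fun n => (A y).indicator
              (fun z => ENNReal.ofReal (s * (z - g (√s * z + n, y)) ^ 2)) z := fun y =>
            (hF y).comp (measurable_prodMk_left (x := z))
          rw [← lintegral_finsetSum t fun y _ => hFz y]
          refine lintegral_mono fun n => ?_
          -- Since `z ∈ A y` forces `y = f z`, at most one term survives, and the estimator is then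
          -- evaluated at the true value of `f`.
          refine (Finset.sum_le_sum (g := fun y => if y = f z then
            ENNReal.ofReal (s * (z - g (√s * z + n, f z)) ^ 2) else 0) fun y _ => ?_).trans ?_
          · by_cases hz : z ∈ A y
            · have hy : z ∈ f ⁻¹' {y} := interior_subset hz
              obtain rfl : f z = y := hy
              simp [hz]
            · simp [hz]
          · rw [Finset.sum_ite_eq']
            split_ifs <;> simp
      _ = ∫⁻ ω, ∫⁻ n, ENNReal.ofReal (s * (Z ω - g (√s * Z ω + n, f (Z ω))) ^ 2)
            ∂(gaussianReal 0 1) ∂P := by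
          rw [← lintegral_map (μ := P) (g := Z) (Measurable.lintegral_prod_right' (f := fun p : ℝ × ℝ =>
            ENNReal.ofReal (s * (p.1 - g (√s * p.1 + p.2, f p.1)) ^ 2)) (by fun_prop)) hZ, hZlaw]
      _ = ∫⁻ q : Ω × ℝ, ENNReal.ofReal (s * (Z q.1 - g (√s * Z q.1 + q.2, f (Z q.1))) ^ 2)
            ∂(P.prod (gaussianReal 0 1)) :=
          (lintegral_prod (fun q : Ω × ℝ =>
            ENNReal.ofReal (s * (Z q.1 - g (√s * Z q.1 + q.2, f (Z q.1))) ^ 2))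
            (by fun_prop)).symm
      _ = ENNReal.ofReal (s * condMMSE P Z (fun ω => f (Z ω)) s) := by
          rw [ENNReal.ofReal_mul hs.le, hgeq, ← lintegral_const_mul _ (by fun_prop)]
          simp_rw [ENNReal.ofReal_mul hs.le]
  have hnonneg : ∀ s, 0 ≤ condMMSE P Z (fun ω => f (Z ω)) s := fun s =>
    integral_nonneg fun _ => sq_nonneg _
  -- `ENNReal.ofReal` truncates negative numbers, so they are treated apart.
  rcases lt_or_ge a 0 with ha0 | ha0
  · filter_upwards [eventually_gt_atTop 0] with s hs
    exact ha0.trans_le (mul_nonneg hs.le (hnonneg s))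
  -- Fatou's lemma is applied along sequences, so the real parameter is replaced by an arbitrary
  -- sequence tending to infinity.
  rw [eventually_iff_seq_eventually]
  intro s hs
  have hlt : ENNReal.ofReal a < liminf (fun m => ∑ y ∈ t, ∫⁻ p : ℝ × ℝ,
      symmWeight (A y) (s m) p * (gaussianPDF 0 1 p.2 * ENNReal.ofReal (p.2 ^ 2))) atTop := by
    refine lt_of_lt_of_le ?_ (hmass.trans (sum_gaussianReal_le_liminf t hA hs))
    rw [← ofReal_measureReal]
    exact (ENNReal.ofReal_lt_ofReal_iff_of_nonneg ha0).2 ha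
  filter_upwards [eventually_lt_of_lt_liminf hlt, hs.eventually_gt_atTop 0] with m h1 h2
  exact (ENNReal.ofReal_lt_ofReal_iff_of_nonneg ha0).1 (h1.trans_le (hlow _ h2))

/-! ### Assembly of the two dimensions. -/

theorem mainTheorem9 {Ω : Type*} [MeasurableSpace Ω] (P : Measure Ω) [IsProbabilityMeasure P]
    (Z : Ω → ℝ) (hZ : Measurable Z) (hZlaw : P.map Z = gaussianReal 0 1)
    (f : ℝ → ℝ) (hf : IsPiecewiseSmooth f)
    (hcrit : ∀ᵐ z : ℝ ∂volume, z ∉ flatSections f → deriv f z ≠ 0)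
    (hH : discreteEntropy P (fun ω => ⌊f (Z ω)⌋) ≠ ∞) :
    ∃ D : ℝ,
      HasCondMMSEDimension P Z (fun ω => f (Z ω)) D ∧
      HasInformationDimension P (fun ω => f (Z ω)) (1 - D) ∧
      D = P.real {ω | f (Z ω) ∈ flatValues f} ∧
      D = P.real {ω | Z ω ∈ flatSections f} := by
  obtain ⟨K, I, hI⟩ := hf.exists_isSmoothPartition
  have hfm := hI.measurable
  have hY : Measurable fun ω => f (Z ω) := hfm.comp hZ
  have hQ := hI.finite_flatValues
  refine ⟨P.real {ω | f (Z ω) ∈ flatValues f}, ?_, ?_, rfl, ?_⟩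
  · exact tendsto_order.2 ⟨fun a ha => hI.eventually_lt_mul_condMMSE hZ hZlaw ha,
      fun b hb => hI.eventually_mul_condMMSE_lt hZ hZlaw hb⟩
  · have : IsProbabilityMeasure (P.map fun ω => f (Z ω)) :=
      Measure.isProbabilityMeasure_map hY.aemeasurable
    have hac : (P.map fun ω => f (Z ω)).restrict (flatValues f)ᶜ ≪ volume := by
      refine Measure.AbsolutelyContinuous.mk fun B hB hB0 => ?_
      rw [Measure.restrict_apply hB, Measure.map_apply hY (hB.inter hQ.measurableSet.compl)]
      have h0 := hI.volume_preimage_diff_flatValues hcrit hB hB0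
      rw [measure_eq_zero_iff_ae_notMem] at h0 ⊢
      exact ae_of_map_eq_gaussianReal hZ hZlaw h0
    rw [discreteEntropy_map P hY Int.measurable_floor] at hH
    obtain ⟨h1, h2⟩ := tendsto_discreteEntropy_floor_mul _ hQ hac hH
    have heq : ∀ M : ℕ, M ≠ 0 → discreteEntropy P (fun ω => quantize M (f (Z ω))) =
        discreteEntropy (P.map fun ω => f (Z ω)) (fun y => ⌊(M : ℝ) * y⌋) := fun M hM => by
      rw [discreteEntropy_quantize P _ hM]
      exact discreteEntropy_map P hY (Int.measurable_floor.comp (measurable_const_mul _))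
    refine ⟨?_, ?_⟩
    · filter_upwards [eventually_ne_atTop 0] with M hM
      rw [heq M hM]
      exact h1 M hM
    · rw [probReal_compl_eq_one_sub hQ.measurableSet, map_measureReal_apply hY hQ.measurableSet] at h2
      refine h2.congr' ?_
      filter_upwards [eventually_ne_atTop 0] with M hM
      rw [heq M hM]
  · refine measureReal_congr ?_
    filter_upwards [ae_of_map_eq_gaussianReal hZ hZlaw hI.ae_flat_or_injOn] with ω hω
    refine propext ⟨fun h => ?_, fun h => map_mem_flatValues_of_mem_flatSections h⟩
    rcases hω with hω | hω
    · exact hω.2.1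
    · exact (hω.1 h).elim
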